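/- Let $\varphi\colon R\to Q$ be a morphism of (associative, unital) rings that is both a monomorphism and an epimorphism in the category of rings, and suppose that $Q$ is flat as a left $R$-module. Suppose that the Gabriel topology $\mathcal F$ of all right ideals $I$ of $R$ with $\varphi(I)Q=Q$ is a 1-topology, i.e. every $I\in\mathcal F$ contains a principal right ideal $sR\in\mathcal F$. Suppose also that $Q$ is directly finite, i.e. $ab=1$ implies $ba=1$ for all $a,b\in Q$. Let $K:=Q/\varphi(R)$, an $R$-$R$-bimodule. A right $R$-module $T$ is torsion if $T\otimes_RQ=0$, and a right $R$-module is torsion-free if it has no nonzero torsion submodule. A right $R$-module $N$ is $h$-divisible if every homomorphism $R_R\to N_R$ extends along $\varphi$ to a homomorphism $Q_R\to N_R$, and a right $R$-module is $h$-reduced if it has no nonzero $h$-divisible submodule. A right $R$-module $N$ is Matlis-cotorsion if $\operatorname{Ext}^1_R(Q_R,N_R)=0$. Let $M_R$ be an $h$-reduced torsion-free right $R$-module, and let $$\lambda\colon M_R\to\operatorname{Hom}(K_R,M\otimes_RK),\qquad \lambda(x)(k)=x\otimes k,$$ be the canonical homomorphism of right $R$-modules, where $\operatorname{Hom}(K_R,M\otimes_RK)$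 is a right $R$-module via $(fr)(k)=f(rk)$. Then $\lambda$ is injective, and its cokernel is isomorphic, as a right $R$-module, to $\operatorname{Ext}^1_R(Q_R,M_R)$, whose right $R$-module structure is induced by left multiplication of $R$ on $Q$. Consequently, if $M_R$ is moreover Matlis-cotorsion, then $\lambda$ is an isomorphism. -/

import Mathlib

open CategoryTheory MulOpposite
open scoped TensorProduct

universe u

/-! Right `R`-modules are modules over `Rᵐᵒᵖ`; the right action `x * r` is `op r • x`. An
`R`-`R`-bimodule is an abelian group `B` with `[Module R B] [Module Rᵐᵒᵖ B]
[SMulCommClass R Rᵐᵒᵖ B]`. -/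

namespace FlatBimorphism

noncomputable section

/-! ### Tensor product over a noncommutative ring -/

section Tensor

variable (R : Type*) [Ring R]

/-- The subgroup of `M ⊗[ℤ] N` generated by all `m r ⊗ n - m ⊗ r n`. -/
def balancedRel (M N : Type*) [AddCommGroup M] [Module Rᵐᵒᵖ M] [AddCommGroup N] [Module R N] :
    AddSubgroup (M ⊗[ℤ] N) :=
  AddSubgroup.closure
    {z | ∃ (m : M) (r : R) (n : N), z = (op r • m) ⊗ₜ[ℤ] n - m ⊗ₜ[ℤ] (r • n)}

/-- The tensor product `M ⊗_R N` of a right `R`-module `M` and a left `R`-module `N`. -/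
def Tensor (M N : Type*) [AddCommGroup M] [Module Rᵐᵒᵖ M] [AddCommGroup N] [Module R N] :
    Type _ :=
  (M ⊗[ℤ] N) ⧸ balancedRel R M N

variable {M N M' N' : Type*}
  [AddCommGroup M] [Module Rᵐᵒᵖ M] [AddCommGroup N] [Module R N]
  [AddCommGroup M'] [Module Rᵐᵒᵖ M'] [AddCommGroup N'] [Module R N']

instance : AddCommGroup (Tensor R M N) :=
  inferInstanceAs (AddCommGroup ((M ⊗[ℤ] N) ⧸ balancedRel R M N))

namespace Tensor

/-- The pure tensor `m ⊗ n` in `M ⊗_R N`. -/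
def tmul (m : M) (n : N) : Tensor R M N :=
  QuotientAddGroup.mk' (balancedRel R M N) (m ⊗ₜ[ℤ] n)

theorem tmul_add (m : M) (n n' : N) : tmul R m (n + n') = tmul R m n + tmul R m n' := by
  simp only [tmul, TensorProduct.tmul_add, map_add]; rfl

theorem add_tmul (m m' : M) (n : N) : tmul R (m + m') n = tmul R m n + tmul R m' n := by
  simp only [tmul, TensorProduct.add_tmul, map_add]; rfl

theorem smul_tmul (r : R) (m : M) (n : N) : tmul R (op r • m) n = tmul R m (r • n) := by
  refine (QuotientAddGroup.eq_iff_sub_mem).2 ?_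
  exact AddSubgroup.subset_closure ⟨m, r, n, rfl⟩

theorem induction_on {p : Tensor R M N → Prop} (z : Tensor R M N) (zero : p 0)
    (tmul : ∀ m n, p (tmul R m n)) (add : ∀ x y, p x → p y → p (x + y)) : p z := by
  obtain ⟨w, rfl⟩ := QuotientAddGroup.mk'_surjective (balancedRel R M N) z
  induction w using TensorProduct.induction_on with
  | zero => rw [map_zero]; exact zero
  | tmul m n => exact tmul m n
  | add x y hx hy => rw [map_add]; exact add _ _ hx hy

theorem hom_ext {A : Type*} [AddCommGroup A] {f g : Tensor R M N →+ A}
    (h : ∀ m n, f (tmul R m n) = g (tmul R m n)) : f = g := by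
  ext z
  induction z using induction_on with
  | zero => simp
  | tmul m n => exact h m n
  | add x y hx hy => rw [map_add, map_add, hx, hy]

/-- The map `f ⊗ g : M ⊗_R N → M' ⊗_R N'`. -/
def map (f : M →ₗ[Rᵐᵒᵖ] M') (g : N →ₗ[R] N') : Tensor R M N →+ Tensor R M' N' :=
  QuotientAddGroup.map (balancedRel R M N) (balancedRel R M' N')
    (TensorProduct.map f.toAddMonoidHom.toIntLinearMap g.toAddMonoidHom.toIntLinearMap).toAddMonoidHom
    (by
      refine (AddSubgroup.closure_le _).2 ?_
      rintro _ ⟨m, r, n, rfl⟩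
      refine AddSubgroup.subset_closure ⟨f m, r, g n, ?_⟩
      simp)

theorem map_tmul (f : M →ₗ[Rᵐᵒᵖ] M') (g : N →ₗ[R] N') (m : M) (n : N) :
    map R f g (tmul R m n) = tmul R (f m) (g n) :=
  rfl

/-- Right multiplication `x ⊗ b ↦ x ⊗ (b r)` on `M ⊗_R B`, for a bimodule `B`. -/
def rightMul (M B : Type*) [AddCommGroup M] [Module Rᵐᵒᵖ M] [AddCommGroup B] [Module R B]
    [Module Rᵐᵒᵖ B] [SMulCommClass R Rᵐᵒᵖ B] : Rᵐᵒᵖ →+* AddMonoid.End (Tensor R M B) :=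
  haveI : SMulCommClass Rᵐᵒᵖ R B := SMulCommClass.symm R Rᵐᵒᵖ B
  { toFun := fun a => map R LinearMap.id (Module.toModuleEnd R B a)
    map_one' := hom_ext R fun m b => congrArg (tmul R m) (one_smul Rᵐᵒᵖ b)
    map_mul' := fun a a' => hom_ext R fun m b => congrArg (tmul R m) (mul_smul a a' b)
    map_zero' := hom_ext R fun m b => by
      have h : tmul R m (0 : B) = 0 := by simpa using tmul_add R m (0 : B) 0
      exact (congrArg (tmul R m) (zero_smul Rᵐᵒᵖ b)).trans h
    map_add' := fun a a' => hom_ext R fun m b =>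
      (congrArg (tmul R m) (add_smul a a' b)).trans (tmul_add R m _ _) }

/-- For a bimodule `B`, the right `R`-module structure of `M ⊗_R B`: `(x ⊗ b) r = x ⊗ (b r)`. -/
instance {B : Type*} [AddCommGroup B] [Module R B] [Module Rᵐᵒᵖ B] [SMulCommClass R Rᵐᵒᵖ B] :
    Module Rᵐᵒᵖ (Tensor R M B) :=
  Module.compHom _ (rightMul R M B)

theorem op_smul_tmul {B : Type*} [AddCommGroup B] [Module R B] [Module Rᵐᵒᵖ B]
    [SMulCommClass R Rᵐᵒᵖ B] (a : Rᵐᵒᵖ) (m : M) (b : B) :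
    a • (tmul R m b : Tensor R M B) = tmul R m (a • b) :=
  rfl

end Tensor

end Tensor

/-- A left `R`-module `N` is flat if `- ⊗_R N` preserves injectivity of right module maps. -/
def LeftFlat (R : Type u) [Ring R] (N : Type u) [AddCommGroup N] [Module R N] : Prop :=
  ∀ (A B : Type u) [AddCommGroup A] [Module Rᵐᵒᵖ A] [AddCommGroup B] [Module Rᵐᵒᵖ B]
    (f : A →ₗ[Rᵐᵒᵖ] B), Function.Injective f →
    Function.Injective (Tensor.map R f (LinearMap.id : N →ₗ[R] N))

/-! ### `Hom` and `Ext` out of a bimodule, as right modules -/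

section HomExt

variable (R : Type u) [Ring R]

/-- `Hom(B_R, N_R)`, for an `R`-`R`-bimodule `B` and a right `R`-module `N`. -/
def RHom (B N : Type*) [AddCommGroup B] [Module Rᵐᵒᵖ B] [AddCommGroup N] [Module Rᵐᵒᵖ N] :
    Type _ :=
  B →ₗ[Rᵐᵒᵖ] N

instance (B N : Type*) [AddCommGroup B] [Module Rᵐᵒᵖ B] [AddCommGroup N] [Module Rᵐᵒᵖ N] :
    AddCommGroup (RHom R B N) :=
  inferInstanceAs (AddCommGroup (B →ₗ[Rᵐᵒᵖ] N))

instance (B N : Type*) [AddCommGroup B] [Module Rᵐᵒᵖ B] [AddCommGroup N] [Module Rᵐᵒᵖ N] :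
    FunLike (RHom R B N) B N :=
  inferInstanceAs (FunLike (B →ₗ[Rᵐᵒᵖ] N) B N)

/-- The right `R`-module structure of `Hom(B_R, N_R)`: `(f r)(b) = f (r b)`. -/
instance (B N : Type*) [AddCommGroup B] [Module R B] [Module Rᵐᵒᵖ B] [SMulCommClass R Rᵐᵒᵖ B]
    [AddCommGroup N] [Module Rᵐᵒᵖ N] : Module Rᵐᵒᵖ (RHom R B N) where
  smul a f := LinearMap.comp (show B →ₗ[Rᵐᵒᵖ] N from f) (Module.toModuleEnd Rᵐᵒᵖ B a.unop)
  one_smul f := LinearMap.ext fun b => congrArg (show B →ₗ[Rᵐᵒᵖ] N from f) (one_smul R b)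
  mul_smul a a' f := LinearMap.ext fun b =>
    congrArg (show B →ₗ[Rᵐᵒᵖ] N from f) (mul_smul a'.unop a.unop b)
  smul_zero _ := rfl
  smul_add _ _ _ := rfl
  add_smul a a' f := LinearMap.ext fun b =>
    (congrArg (show B →ₗ[Rᵐᵒᵖ] N from f) (add_smul a.unop a'.unop b)).trans
      (map_add (show B →ₗ[Rᵐᵒᵖ] N from f) _ _)
  zero_smul f := LinearMap.ext fun b =>
    (congrArg (show B →ₗ[Rᵐᵒᵖ] N from f) (zero_smul R b)).trans
      (map_zero (show B →ₗ[Rᵐᵒᵖ] N from f))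

theorem RHom.smul_apply {B N : Type*} [AddCommGroup B] [Module R B] [Module Rᵐᵒᵖ B]
    [SMulCommClass R Rᵐᵒᵖ B] [AddCommGroup N] [Module Rᵐᵒᵖ N] (r : R) (f : RHom R B N) (b : B) :
    (op r • f) b = f (r • b) :=
  rfl

/-- `Ext¹_R(B_R, N_R)`, computed in the category of right `R`-modules. -/
def RExt (B N : Type u) [AddCommGroup B] [Module Rᵐᵒᵖ B] [AddCommGroup N] [Module Rᵐᵒᵖ N] :
    Type u :=
  Abelian.Ext.{u} (ModuleCat.of Rᵐᵒᵖ B) (ModuleCat.of Rᵐᵒᵖ N) 1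

instance (B N : Type u) [AddCommGroup B] [Module Rᵐᵒᵖ B] [AddCommGroup N] [Module Rᵐᵒᵖ N] :
    AddCommGroup (RExt R B N) :=
  inferInstanceAs (AddCommGroup
    (Abelian.Ext.{u} (ModuleCat.of Rᵐᵒᵖ B) (ModuleCat.of Rᵐᵒᵖ N) 1))

/-- Left multiplication `b ↦ r b` on a bimodule, as a morphism of right `R`-modules. -/
def leftMul (B : Type u) [AddCommGroup B] [Module R B] [Module Rᵐᵒᵖ B] [SMulCommClass R Rᵐᵒᵖ B]
    (r : R) : ModuleCat.of Rᵐᵒᵖ B ⟶ ModuleCat.of Rᵐᵒᵖ B :=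
  ModuleCat.ofHom (Module.toModuleEnd Rᵐᵒᵖ B r)

/-- The right `R`-module structure of `Ext¹_R(B_R, N_R)`, induced by the left `R`-module structure
of `B`: `e r` is the image of `e` under `Ext¹_R(b ↦ r b, N)`. -/
instance (B N : Type u) [AddCommGroup B] [Module R B] [Module Rᵐᵒᵖ B] [SMulCommClass R Rᵐᵒᵖ B]
    [AddCommGroup N] [Module Rᵐᵒᵖ N] : Module Rᵐᵒᵖ (RExt R B N) where
  smul a e := (Abelian.Ext.mk₀ (leftMul R B a.unop)).comp
    (show Abelian.Ext.{u} (ModuleCat.of Rᵐᵒᵖ B) (ModuleCat.of Rᵐᵒᵖ N) 1 from e) (zero_add 1)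
  one_smul e := by
    have h : leftMul R B 1 = 𝟙 _ := by ext b; exact one_smul R b
    change (Abelian.Ext.mk₀ (leftMul R B 1)).comp _ _ = _
    rw [h]; exact Abelian.Ext.mk₀_id_comp _
  mul_smul a a' e := by
    have h : leftMul R B (a'.unop * a.unop) = leftMul R B a.unop ≫ leftMul R B a'.unop := by
      ext b; exact mul_smul a'.unop a.unop b
    change (Abelian.Ext.mk₀ (leftMul R B (a'.unop * a.unop))).comp _ _ = _
    rw [h]; exact (Abelian.Ext.mk₀_comp_mk₀_assoc (leftMul R B a.unop) (leftMul R B a'.unop) _).symm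
  smul_zero a := Abelian.Ext.comp_zero.{u} (Abelian.Ext.mk₀ (leftMul R B a.unop)) (ModuleCat.of Rᵐᵒᵖ N) 1 1 (zero_add 1)
  smul_add a e e' := Abelian.Ext.comp_add (Abelian.Ext.mk₀ (leftMul R B a.unop)) _ _ (zero_add 1)
  add_smul a a' e := by
    have h : leftMul R B (a.unop + a'.unop) = leftMul R B a.unop + leftMul R B a'.unop := by
      ext b; exact add_smul a.unop a'.unop b
    change (Abelian.Ext.mk₀ (leftMul R B (a.unop + a'.unop))).comp _ _ = _
    rw [h, Abelian.Ext.mk₀_add]; exact Abelian.Ext.add_comp _ _ _ _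
  zero_smul e := by
    have h : leftMul R B 0 = 0 := by ext b; exact zero_smul R b
    change (Abelian.Ext.mk₀ (leftMul R B 0)).comp _ _ = _
    rw [h, Abelian.Ext.mk₀_zero]; exact Abelian.Ext.zero_comp (ModuleCat.of Rᵐᵒᵖ B) 0
      (show Abelian.Ext.{u} (ModuleCat.of Rᵐᵒᵖ B) (ModuleCat.of Rᵐᵒᵖ N) 1 from e) 1 (zero_add 1)

end HomExt

/-! ### The bimodules `Q` and `K = Q / φ(R)` of a ring morphism `φ : R → Q` -/

section Bimodules

variable {R Q : Type u} [Ring R] [Ring Q] (φ : R →+* Q)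

/-- The ring `Q`, regarded as an `R`-`R`-bimodule through `φ`. -/
def QBimod (_ : R →+* Q) : Type u := Q

instance : AddCommGroup (QBimod φ) := inferInstanceAs (AddCommGroup Q)

/-- `r • q = φ r * q`. -/
instance : Module R (QBimod φ) := Module.compHom Q φ

/-- `op r • q = q * φ r`. -/
instance : Module Rᵐᵒᵖ (QBimod φ) := Module.compHom Q (RingHom.op φ)

instance : SMulCommClass R Rᵐᵒᵖ (QBimod φ) where
  smul_comm r a q := (mul_assoc (φ r) (show Q from q) (φ a.unop)).symm

/-- `φ`, as a morphism of right `R`-modules `R → Q`. -/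
def toQ : R →ₗ[Rᵐᵒᵖ] QBimod φ where
  toFun := φ
  map_add' := φ.map_add
  map_smul' a r := φ.map_mul r a.unop

/-- `K = Q / φ(R)`. -/
def KBimod : Type u := QBimod φ ⧸ LinearMap.range (toQ φ)

instance : AddCommGroup (KBimod φ) :=
  inferInstanceAs (AddCommGroup (QBimod φ ⧸ LinearMap.range (toQ φ)))

instance : Module Rᵐᵒᵖ (KBimod φ) :=
  inferInstanceAs (Module Rᵐᵒᵖ (QBimod φ ⧸ LinearMap.range (toQ φ)))

/-- The class `q + φ(R)` in `K`. -/
def toK : QBimod φ →ₗ[Rᵐᵒᵖ] KBimod φ := (LinearMap.range (toQ φ)).mkQ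

/-- Left multiplication `q + φ(R) ↦ φ(r) q + φ(R)` on `K`. -/
def KleftMul : R →+* Module.End Rᵐᵒᵖ (KBimod φ) where
  toFun r := (LinearMap.range (toQ φ)).mapQ (LinearMap.range (toQ φ))
    (Module.toModuleEnd Rᵐᵒᵖ (QBimod φ) r) (by
      rintro _ ⟨x, rfl⟩
      exact ⟨r * x, φ.map_mul r x⟩)
  map_one' := Submodule.linearMap_qext _ (LinearMap.ext fun q =>
    congrArg (toK φ) (one_smul R q))
  map_mul' r s := Submodule.linearMap_qext _ (LinearMap.ext fun q =>
    congrArg (toK φ) (mul_smul r s q))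
  map_zero' := Submodule.linearMap_qext _ (LinearMap.ext fun q =>
    congrArg (toK φ) (zero_smul R q))
  map_add' r s := Submodule.linearMap_qext _ (LinearMap.ext fun q =>
    congrArg (toK φ) (add_smul r s q))

instance : Module R (KBimod φ) := Module.compHom (KBimod φ) (KleftMul φ)

theorem smul_toK (r : R) (q : QBimod φ) : r • toK φ q = toK φ (r • q) := rfl

instance : SMulCommClass R Rᵐᵒᵖ (KBimod φ) where
  smul_comm r a k := (KleftMul φ r).map_smul a k

/-! ### The hypotheses on `φ : R → Q` -/

/-- `φ` is a monomorphism and an epimorphism in the category of rings, and `Q` is flat as a left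
`R`-module. -/
structure IsLeftFlatBimorphism : Prop where
  injective : Function.Injective φ
  epi : Epi (RingCat.ofHom φ)
  flat : LeftFlat R (QBimod φ)

/-- The family `ℱ` of all right ideals `I` of `R` with `φ(I) Q = Q`. -/
def gabriel : Set (Submodule Rᵐᵒᵖ R) :=
  {I | Submodule.span Qᵐᵒᵖ (φ '' (I : Set R)) = ⊤}

/-- `ℱ` is a 1-topology: it has a basis consisting of principal right ideals `sR`. -/
def IsOneTopology : Prop :=
  ∀ I ∈ gabriel φ, ∃ s : R, Submodule.span Rᵐᵒᵖ {s} ∈ gabriel φ ∧ Submodule.span Rᵐᵒᵖ {s} ≤ I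

/-! ### Classes of right `R`-modules, relative to `φ` -/

variable (M : Type u) [AddCommGroup M] [Module Rᵐᵒᵖ M]

/-- `M` is torsion: `M ⊗_R Q = 0`. -/
def IsTorsion : Prop := Subsingleton (Tensor R M (QBimod φ))

/-- `M` is torsion-free: its torsion submodule is zero, i.e. `0` is its only torsion submodule. -/
def IsTorsionFree : Prop := ∀ N : Submodule Rᵐᵒᵖ M, IsTorsion φ N → N = ⊥

/-- `M` is `h`-divisible: every homomorphism `R → M` of right modules extends to `Q → M`. -/
def IsHDivisible : Prop :=
  ∀ f : R →ₗ[Rᵐᵒᵖ] M, ∃ g : QBimod φ →ₗ[Rᵐᵒᵖ] M, g ∘ₗ toQ φ = f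

/-- `M` is `h`-reduced: it has no nonzero `h`-divisible submodule. -/
def IsHReduced : Prop := ∀ N : Submodule Rᵐᵒᵖ M, IsHDivisible φ N → N = ⊥

/-- `M` is Matlis-cotorsion: `Ext¹_R(Q_R, M_R) = 0`. -/
def IsMatlisCotorsion : Prop := Subsingleton (RExt R (QBimod φ) M)

/-- The canonical map `λ : M → Hom(K_R, M ⊗_R K)`, `λ(x)(k) = x ⊗ k`. -/
def canonicalMap : M →ₗ[Rᵐᵒᵖ] RHom R (KBimod φ) (Tensor R M (KBimod φ)) where
  toFun x := (show KBimod φ →ₗ[Rᵐᵒᵖ] Tensor R M (KBimod φ) from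
    { toFun := fun k => Tensor.tmul R x k
      map_add' := Tensor.tmul_add R x
      map_smul' := fun _ _ => rfl })
  map_add' x y := LinearMap.ext fun k => Tensor.add_tmul R x y k
  map_smul' a x := LinearMap.ext fun k => Tensor.smul_tmul R a.unop x k

theorem canonicalMap_apply (x : M) (k : KBimod φ) : canonicalMap φ M x k = Tensor.tmul R x k := rfl

end Bimodules

end

end FlatBimorphism

/-!
Since `Q` is flat on the left, `M → M ⊗ Q` has torsion kernel, so for `M` torsion-free there is a
short exact sequence `0 → M → M ⊗ Q → M ⊗ K → 0` of right `R`-modules. The theorem is read off from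
its long exact sequence for `Hom(Q, -)`,
`Hom(Q, M) → Hom(Q, M ⊗ Q) → Hom(Q, M ⊗ K) → Ext¹(Q, M) → Ext¹(Q, M ⊗ Q)`,
together with three facts.

* `Hom(Q, M) = 0` for `M` `h`-reduced (`hom_eq_zero_of_isHReduced`), since a homomorphic image of
  `Q` is `h`-divisible.
* Every `R`-linear `h : Q → M ⊗ Q` is multiplication by `h(1)` (`eq_mulLeftTensor`). This rests on
  the identity `x ⊗ 1 = 1 ⊗ x` in `Q ⊗_R Q`, a form of `φ` being a ring epimorphism
  (`tmul_one_eq_one_tmul`).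
* `Ext¹(Q, M ⊗ Q) = 0` (`subsingleton_ext_tensor`). Over a projective presentation
  `0 → Z → P → Q → 0`, flatness and the same identity show that each `Z → M ⊗ Q` extends to `P`
  (`exists_extension_of_ker`).

A morphism `K → M ⊗ K` is a morphism `Q → M ⊗ K` vanishing at `1`, and composing with the connecting
homomorphism gives `connectingMap : Hom(K, M ⊗ K) → Ext¹(Q, M)`. It is surjective because any
`Q → M ⊗ K` can be made to vanish at `1` by subtracting a morphism that factors through `M ⊗ Q`. Its
kernel consists of the `f` whose composite with `Q → K` lifts to `q ↦ t q` with `t ∈ M ⊗ Q`; then `t`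
maps to `f(0) = 0`, so `t = x ⊗ 1` and `f = λ(x)`. If `λ(x) = 0`, then `q ↦ x ⊗ q` is a morphism
from `Q` to `M ⊆ M ⊗ Q`, so it vanishes and `x = 0`.
-/

namespace FlatBimorphism

/-! ### Balanced maps and right exactness of the tensor product -/

namespace Tensor

section

variable (R : Type*) [Ring R] {M N A : Type*} [AddCommGroup M] [Module Rᵐᵒᵖ M]
  [AddCommGroup N] [Module R N] [AddCommGroup A]

/-- The additive map out of `M ⊗_R N` induced by a balanced biadditive map. -/
def lift (f : M →+ N →+ A) (hf : ∀ (m : M) (r : R) (n : N), f (op r • m) n = f m (r • n)) :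
    Tensor R M N →+ A :=
  QuotientAddGroup.lift (balancedRel R M N)
    (TensorProduct.liftAddHom f fun r m n => by simp)
    (by
      refine (AddSubgroup.closure_le _).2 ?_
      rintro _ ⟨m, r, n, rfl⟩
      simp [hf])

/-- The biadditive map `(m, n) ↦ m ⊗ n`. -/
def mk (M N : Type*) [AddCommGroup M] [Module Rᵐᵒᵖ M] [AddCommGroup N] [Module R N] :
    M →+ N →+ Tensor R M N :=
  AddMonoidHom.mk' (fun m => AddMonoidHom.mk' (tmul R m) (tmul_add R m))
    fun m m' => AddMonoidHom.ext fun n => add_tmul R m m' n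

theorem tmul_zero (m : M) : tmul R m (0 : N) = 0 := map_zero (mk R M N m)

theorem sub_tmul (m m' : M) (n : N) : tmul R (m - m') n = tmul R m n - tmul R m' n :=
  map_sub ((mk R M N).flip n) m m'

/-- Right exactness of the tensor product in the first variable: for a surjection `p : B → C`, the
kernel of `B ⊗ N → C ⊗ N` is the image of `ker p ⊗ N`. -/
theorem exists_map_ker_subtype {B C : Type*} [AddCommGroup B] [Module Rᵐᵒᵖ B] [AddCommGroup C]
    [Module Rᵐᵒᵖ C] (p : B →ₗ[Rᵐᵒᵖ] C) (hp : Function.Surjective p) (t : Tensor R B N)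
    (ht : map R p (LinearMap.id : N →ₗ[R] N) t = 0) :
    ∃ s : Tensor R (LinearMap.ker p) N,
      map R (LinearMap.ker p).subtype (LinearMap.id : N →ₗ[R] N) s = t := by
  let I := (map R (LinearMap.ker p).subtype (LinearMap.id : N →ₗ[R] N)).range
  have hI : ∀ b b' : B, p b = p b' → ∀ n : N,
      (QuotientAddGroup.mk' I) (tmul R b n) = QuotientAddGroup.mk' I (tmul R b' n) := by
    intro b b' h n
    rw [← sub_eq_zero, ← map_sub, ← sub_tmul]
    refine (QuotientAddGroup.eq_zero_iff _).2 ⟨tmul R ⟨b - b', by simp [h]⟩ n, rfl⟩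
  let σ := Function.surjInv hp
  have hσ : ∀ c, p (σ c) = c := Function.surjInv_eq hp
  -- the inverse `C ⊗ N → (B ⊗ N) / im (ker p ⊗ N)` of the induced map
  let g : Tensor R C N →+ Tensor R B N ⧸ I := lift R
    (AddMonoidHom.mk' (fun c => (QuotientAddGroup.mk' I).comp (mk R B N (σ c)))
      fun c c' => AddMonoidHom.ext fun n => by
        have := hI (σ (c + c')) (σ c + σ c') (by simp [hσ]) n
        rw [add_tmul, map_add] at this
        exact this)
    fun c r n => by
      have := hI (σ (op r • c)) (op r • σ c) (by simp [hσ]) n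
      rw [smul_tmul] at this
      exact this
  have hg : g.comp (map R p LinearMap.id) = QuotientAddGroup.mk' I :=
    hom_ext R fun b n => hI (σ (p b)) b (hσ _) n
  have h0 : QuotientAddGroup.mk' I t = 0 := by
    rw [← hg, AddMonoidHom.comp_apply, ht, map_zero]
  exact (QuotientAddGroup.eq_zero_iff _).1 h0

end

end Tensor

section

variable {R Q : Type u} [Ring R] [Ring Q] (φ : R →+* Q)

/-! ### Ring epimorphisms and automatic `Q`-linearity -/

/-- Right multiplication by `q` on `Q`, as a morphism of left `R`-modules. -/
def mulRightQ (q : Q) : QBimod φ →ₗ[R] QBimod φ where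
  toFun x := (show Q from x) * q
  map_add' x y := add_mul (show Q from x) y q
  map_smul' r x := mul_assoc (φ r) (show Q from x) q

/-- Left multiplication by `q` on `Q`, as a morphism of right `R`-modules. -/
def mulLeftQ (q : Q) : QBimod φ →ₗ[Rᵐᵒᵖ] QBimod φ where
  toFun x := q * (show Q from x)
  map_add' x y := mul_add q (show Q from x) y
  map_smul' a x := (mul_assoc q (show Q from x) (φ a.unop)).symm

/-- The unit element of `Q`. -/
def oneQ : QBimod φ := (1 : Q)

theorem toQ_apply (r : R) : toQ φ r = r • oneQ φ := (mul_one (φ r)).symm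

theorem op_smul_oneQ (r : R) : op r • oneQ φ = r • oneQ φ :=
  (one_mul (φ r)).trans (mul_one (φ r)).symm

/-- In `Q ⊗_R Q` one has `x ⊗ 1 = 1 ⊗ x` when `φ : R → Q` is an epimorphism of rings. On
`Q × (Q ⊗_R Q)` there are two left actions of `Q`, the componentwise one and its conjugate by the
automorphism `(a, t) ↦ (a, t + 1 ⊗ a)`; they agree on `R`, hence on `Q`. -/
theorem tmul_one_eq_one_tmul (hφ : Epi (RingCat.ofHom φ)) (x : QBimod φ) :
    Tensor.tmul R x (oneQ φ) = Tensor.tmul R (oneQ φ) x := by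
  let T := Tensor R (QBimod φ) (QBimod φ)
  -- the left action of `Q` on the first factor of `Q ⊗ Q`, and `u(a) = 1 ⊗ a`
  let L : Q → T →+ T := fun q => Tensor.map R (mulLeftQ φ q) LinearMap.id
  let u : Q →+ T := Tensor.mk R (QBimod φ) (QBimod φ) (oneQ φ)
  have L_one : L 1 = AddMonoidHom.id T := Tensor.hom_ext R fun m n =>
    congrArg (fun z : Q => Tensor.tmul R (show QBimod φ from z) n) (one_mul (show Q from m))
  have L_mul : ∀ p q t, L (p * q) t = L p (L q t) := fun p q =>
    DFunLike.congr_fun (f := L (p * q)) (g := (L p).comp (L q)) <| Tensor.hom_ext R fun m n =>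
      congrArg (fun z : Q => Tensor.tmul R (show QBimod φ from z) n)
        (mul_assoc p q (show Q from m))
  have L_add : ∀ p q t, L (p + q) t = L p t + L q t := fun p q =>
    DFunLike.congr_fun (f := L (p + q)) (g := L p + L q) <| Tensor.hom_ext R fun m n =>
      (congrArg (fun z : Q => Tensor.tmul R (show QBimod φ from z) n)
        (add_mul p q (show Q from m))).trans (Tensor.add_tmul R _ _ n)
  have L_zero : ∀ t, L 0 t = 0 := fun t => by simpa using L_add 0 0 t
  let α : Q →+* AddMonoid.End (Q × T) :=
    { toFun := fun q => (AddMonoidHom.mulLeft q).prodMap (L q)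
      map_one' := by
        refine AddMonoidHom.ext fun z => Prod.ext (one_mul z.1) ?_
        exact DFunLike.congr_fun L_one z.2
      map_mul' := fun p q => AddMonoidHom.ext fun z =>
        Prod.ext (mul_assoc p q z.1) (L_mul p q z.2)
      map_zero' := AddMonoidHom.ext fun z => Prod.ext (zero_mul z.1) (L_zero z.2)
      map_add' := fun p q => AddMonoidHom.ext fun z =>
        Prod.ext (add_mul p q z.1) (L_add p q z.2) }
  let U : AddMonoid.End (Q × T) :=
    (AddMonoidHom.fst Q T).prod (AddMonoidHom.snd Q T + u.comp (AddMonoidHom.fst Q T))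
  let U' : AddMonoid.End (Q × T) :=
    (AddMonoidHom.fst Q T).prod (AddMonoidHom.snd Q T - u.comp (AddMonoidHom.fst Q T))
  have hUU' : U * U' = 1 := AddMonoidHom.ext fun z => Prod.ext rfl (sub_add_cancel z.2 (u z.1))
  have hU'U : U' * U = 1 := AddMonoidHom.ext fun z =>
    Prod.ext rfl (add_sub_cancel_right z.2 (u z.1))
  let β : Q →+* AddMonoid.End (Q × T) :=
    { toFun := fun q => U * α q * U'
      map_one' := by rw [map_one, mul_one, hUU']
      map_mul' := fun p q => by
        rw [map_mul]
        calc U * (α p * α q) * U' = U * α p * 1 * α q * U' := by simp only [mul_assoc, mul_one]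
          _ = _ := by rw [← hU'U]; simp only [mul_assoc]
      map_zero' := by rw [map_zero, mul_zero, zero_mul]
      map_add' := fun p q => by rw [map_add, mul_add, add_mul] }
  have hβ : ∀ q z, β q z = (q * z.1, L q (z.2 - u z.1) + u (q * z.1)) := fun q z => rfl
  have hα : ∀ q z, α q z = (q * z.1, L q z.2) := fun q z => rfl
  have hR : α.comp φ = β.comp φ := RingHom.ext fun r => AddMonoidHom.ext fun z => by
    refine (hα (φ r) z).trans (Eq.trans ?_ (hβ (φ r) z).symm)
    have h : L (φ r) (u z.1) = u (φ r * z.1) := by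
      change Tensor.tmul R (r • oneQ φ) (show QBimod φ from z.1)
        = Tensor.tmul R (oneQ φ) (r • (show QBimod φ from z.1))
      rw [← op_smul_oneQ, Tensor.smul_tmul]
    rw [map_sub, h, sub_add_cancel]
  have hαβ : α = β := by
    have := (cancel_epi (RingCat.ofHom φ)).1
      (show RingCat.ofHom φ ≫ RingCat.ofHom α = RingCat.ofHom φ ≫ RingCat.ofHom β from
        RingCat.hom_ext hR)
    exact congrArg RingCat.Hom.hom this
  have key : (β x (1, 0)).2 = (α x (1, 0)).2 := by rw [hαβ]
  have h : L x (0 - u 1) + u ((show Q from x) * 1) = L x 0 := key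
  rw [map_sub, map_zero, zero_sub, neg_add_eq_zero] at h
  have hl : L x (u 1) = Tensor.tmul R x (oneQ φ) :=
    congrArg (fun z : Q => Tensor.tmul R (show QBimod φ from z) (oneQ φ)) (mul_one (show Q from x))
  have hr : u ((show Q from x) * 1) = Tensor.tmul R (oneQ φ) x :=
    congrArg u (mul_one (show Q from x))
  exact hl.symm.trans (h.trans hr)

variable (M : Type u) [AddCommGroup M] [Module Rᵐᵒᵖ M]

/-- Right multiplication `m ⊗ x ↦ m ⊗ x q` by an element `q` of `Q` on `M ⊗_R Q`. -/
def tensorMulRight (q : Q) : Tensor R M (QBimod φ) →+ Tensor R M (QBimod φ) :=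
  Tensor.map R LinearMap.id (mulRightQ φ q)

theorem tensorMulRight_one (t : Tensor R M (QBimod φ)) : tensorMulRight φ M 1 t = t :=
  DFunLike.congr_fun (f := tensorMulRight φ M 1) (g := AddMonoidHom.id _)
    (Tensor.hom_ext R fun m n =>
      congrArg (fun z : Q => Tensor.tmul R m (show QBimod φ from z)) (mul_one (show Q from n))) t

theorem tensorMulRight_add (p q : Q) (t : Tensor R M (QBimod φ)) :
    tensorMulRight φ M (p + q) t = tensorMulRight φ M p t + tensorMulRight φ M q t :=
  DFunLike.congr_fun (f := tensorMulRight φ M (p + q))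
    (g := tensorMulRight φ M p + tensorMulRight φ M q) (Tensor.hom_ext R fun m n =>
      (congrArg (fun z : Q => Tensor.tmul R m (show QBimod φ from z))
        (mul_add (show Q from n) p q)).trans (Tensor.tmul_add R m _ _)) t

theorem tensorMulRight_mul (p q : Q) (t : Tensor R M (QBimod φ)) :
    tensorMulRight φ M (p * q) t = tensorMulRight φ M q (tensorMulRight φ M p t) :=
  DFunLike.congr_fun (f := tensorMulRight φ M (p * q))
    (g := (tensorMulRight φ M q).comp (tensorMulRight φ M p)) (Tensor.hom_ext R fun m n =>
      congrArg (fun z : Q => Tensor.tmul R m (show QBimod φ from z))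
        (mul_assoc (show Q from n) p q).symm) t

/-- The morphism `Q → M ⊗_R Q`, `q ↦ t q`, of right `R`-modules. -/
def mulLeftTensor (t : Tensor R M (QBimod φ)) : QBimod φ →ₗ[Rᵐᵒᵖ] Tensor R M (QBimod φ) where
  toFun q := tensorMulRight φ M q t
  map_add' p q := tensorMulRight_add φ M p q t
  map_smul' a q := tensorMulRight_mul φ M q (φ a.unop) t

theorem mulLeftTensor_one (t : Tensor R M (QBimod φ)) : mulLeftTensor φ M t (oneQ φ) = t :=
  tensorMulRight_one φ M t

/-- For a morphism `g : Z → M ⊗_R Q` of right `R`-modules, the induced map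
`Z ⊗_R Q → M ⊗_R Q`, `z ⊗ q ↦ g(z) q`. -/
def extendScalars {Z : Type u} [AddCommGroup Z] [Module Rᵐᵒᵖ Z]
    (g : Z →ₗ[Rᵐᵒᵖ] Tensor R M (QBimod φ)) :
    Tensor R Z (QBimod φ) →ₗ[Rᵐᵒᵖ] Tensor R M (QBimod φ) :=
  let F : Tensor R Z (QBimod φ) →+ Tensor R M (QBimod φ) := Tensor.lift R
    (AddMonoidHom.mk' (fun z => (mulLeftTensor φ M (g z)).toAddMonoidHom)
      fun z z' => AddMonoidHom.ext fun q => by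
        change tensorMulRight φ M q (g (z + z')) =
          tensorMulRight φ M q (g z) + tensorMulRight φ M q (g z')
        rw [map_add, map_add])
    fun z r q => by
      change tensorMulRight φ M q (g (op r • z)) = tensorMulRight φ M (φ r * (show Q from q)) (g z)
      rw [tensorMulRight_mul, map_smul]
      rfl
  { toFun := F
    map_add' := F.map_add
    map_smul' := fun a t => by
      induction t using Tensor.induction_on with
      | zero => simp
      | tmul z q => exact (mulLeftTensor φ M (g z)).map_smul a q
      | add s t hs ht => rw [smul_add, map_add, hs, ht, map_add, smul_add] }

theorem extendScalars_tmul {Z : Type u} [AddCommGroup Z] [Module Rᵐᵒᵖ Z]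
    (g : Z →ₗ[Rᵐᵒᵖ] Tensor R M (QBimod φ)) (z : Z) (q : QBimod φ) :
    extendScalars φ M g (Tensor.tmul R z q) = mulLeftTensor φ M (g z) q :=
  rfl

/-- A morphism `h : Q → M ⊗_R Q` of right `R`-modules is automatically `Q`-linear, that is,
`h(q) = h(1) q`: apply `x ⊗ q ↦ h(x) q` to `q ⊗ 1 = 1 ⊗ q`. -/
theorem eq_mulLeftTensor (hφ : Epi (RingCat.ofHom φ))
    (h : QBimod φ →ₗ[Rᵐᵒᵖ] Tensor R M (QBimod φ)) : h = mulLeftTensor φ M (h (oneQ φ)) := by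
  ext q
  rw [← extendScalars_tmul, ← tmul_one_eq_one_tmul φ hφ, extendScalars_tmul, mulLeftTensor_one]

/-! ### Vanishing of `Ext¹(Q, M ⊗ Q)` -/

/-- The morphism `f ⊗ id : M ⊗_R Q → N ⊗_R Q`, as a morphism of right `R`-modules. -/
def tensorMapQ {M N : Type u} [AddCommGroup M] [Module Rᵐᵒᵖ M] [AddCommGroup N] [Module Rᵐᵒᵖ N]
    (f : M →ₗ[Rᵐᵒᵖ] N) : Tensor R M (QBimod φ) →ₗ[Rᵐᵒᵖ] Tensor R N (QBimod φ) where
  toFun := Tensor.map R f LinearMap.id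
  map_add' := map_add _
  map_smul' a t := by
    induction t using Tensor.induction_on with
    | zero => simp
    | tmul z q => rfl
    | add s t hs ht => rw [smul_add, map_add, hs, ht, map_add, RingHom.id_apply, smul_add]

/-- The canonical morphism `M → M ⊗_R Q`, `x ↦ x ⊗ 1`. -/
def toTensorQ : M →ₗ[Rᵐᵒᵖ] Tensor R M (QBimod φ) where
  toFun x := Tensor.tmul R x (oneQ φ)
  map_add' x y := Tensor.add_tmul R x y _
  map_smul' a x := by
    rw [RingHom.id_apply, Tensor.op_smul_tmul, ← op_unop a, Tensor.smul_tmul, op_smul_oneQ]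

/-- For `p` in a right module `P` with a surjection `π : P → Q`, and `p₀` with `π(p₀) = 1`, the
element `p ⊗ 1 - p₀ ⊗ π(p)` of `P ⊗_R Q` maps to `π(p) ⊗ 1 - 1 ⊗ π(p) = 0` in `Q ⊗_R Q`, so it comes
from a unique element of `ker π ⊗_R Q`; composing with `ker π ⊗_R Q → M ⊗_R Q` extends any
`g : ker π → M ⊗_R Q` to `P`. -/
theorem exists_extension_of_ker (hφ : IsLeftFlatBimorphism φ) {P : Type u} [AddCommGroup P]
    [Module Rᵐᵒᵖ P] (π : P →ₗ[Rᵐᵒᵖ] QBimod φ) (hπ : Function.Surjective π)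
    (g : LinearMap.ker π →ₗ[Rᵐᵒᵖ] Tensor R M (QBimod φ)) :
    ∃ g' : P →ₗ[Rᵐᵒᵖ] Tensor R M (QBimod φ), g' ∘ₗ (LinearMap.ker π).subtype = g := by
  obtain ⟨p₀, hp₀⟩ := hπ (oneQ φ)
  let ι := tensorMapQ φ (LinearMap.ker π).subtype
  have hι : Function.Injective ι := hφ.flat _ _ _ (Submodule.injective_subtype _)
  let d : P →ₗ[Rᵐᵒᵖ] Tensor R P (QBimod φ) :=
    toTensorQ φ P -
      (show QBimod φ →ₗ[Rᵐᵒᵖ] Tensor R P (QBimod φ) from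
        { toFun := Tensor.tmul R p₀
          map_add' := Tensor.tmul_add R p₀
          map_smul' := fun _ _ => rfl }) ∘ₗ π
  have hd : ∀ p, d p = Tensor.tmul R p (oneQ φ) - Tensor.tmul R p₀ (π p) := fun p => rfl
  have hrange : ∀ p, d p ∈ LinearMap.range ι := by
    intro p
    obtain ⟨s, hs⟩ := Tensor.exists_map_ker_subtype R π hπ (d p) (by
      rw [hd, map_sub, Tensor.map_tmul, Tensor.map_tmul, hp₀]
      exact sub_eq_zero.2 (tmul_one_eq_one_tmul φ hφ.epi (π p)))
    exact ⟨s, hs⟩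
  let e := LinearEquiv.ofInjective ι hι
  refine ⟨extendScalars φ M g ∘ₗ e.symm.toLinearMap ∘ₗ d.codRestrict _ hrange,
    LinearMap.ext fun z => ?_⟩
  have hz : e (Tensor.tmul R z (oneQ φ)) = d.codRestrict _ hrange z := Subtype.ext <| by
    change Tensor.tmul R (z : P) (oneQ φ) = d z
    rw [hd, show π z = 0 from z.2, Tensor.tmul_zero, sub_zero]
  change extendScalars φ M g (e.symm (d.codRestrict _ hrange z)) = g z
  rw [← hz, LinearEquiv.symm_apply_apply, extendScalars_tmul, mulLeftTensor_one]

/-- `Ext¹(Q, M ⊗_R Q) = 0`. In a projective presentation `0 → ker π → P → Q → 0`, every class is the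
image of some `ker π → M ⊗_R Q` under the connecting map, and that morphism extends to `P`. -/
theorem subsingleton_ext_tensor (hφ : IsLeftFlatBimorphism φ) :
    Subsingleton (Abelian.Ext.{u} (ModuleCat.of Rᵐᵒᵖ (QBimod φ))
      (ModuleCat.of Rᵐᵒᵖ (Tensor R M (QBimod φ))) 1) := by
  refine subsingleton_of_forall_eq 0 fun x => ?_
  let X := ModuleCat.of Rᵐᵒᵖ (QBimod φ)
  let π := (Projective.π X).hom
  have hπ : Function.Surjective π := (ModuleCat.epi_iff_surjective (Projective.π X)).1 inferInstance
  have hS := LinearMap.shortExact_shortComplexKer hπ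
  have : Projective π.shortComplexKer.X₂ := inferInstanceAs (Projective (Projective.over X))
  obtain ⟨y, rfl⟩ := Abelian.Ext.contravariant_sequence_exact₃ hS _ x
    (Abelian.Ext.eq_zero_of_projective _) (add_zero 1)
  obtain ⟨g, rfl⟩ := Abelian.Ext.mk₀_bijective _ _ |>.2 y
  obtain ⟨g', hg'⟩ := exists_extension_of_ker φ M hφ π hπ g.hom
  have : g = π.shortComplexKer.f ≫ ModuleCat.ofHom g' := ModuleCat.hom_ext hg'.symm
  rw [this, ← Abelian.Ext.mk₀_comp_mk₀, hS.extClass_comp_assoc]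

/-! ### The exact sequence `0 → M → M ⊗ Q → M ⊗ K → 0` -/

/-- The canonical morphism `M ⊗_R Q → M ⊗_R K`. -/
def tensorToK : Tensor R M (QBimod φ) →ₗ[Rᵐᵒᵖ] Tensor R M (KBimod φ) :=
  let p : QBimod φ →ₗ[R] KBimod φ :=
    { toFun := toK φ, map_add' := map_add _, map_smul' := fun r q => (smul_toK φ r q).symm }
  { toFun := Tensor.map R LinearMap.id p
    map_add' := map_add _
    map_smul' := fun a t => by
      induction t using Tensor.induction_on with
      | zero => simp
      | tmul z q => exact congrArg (Tensor.tmul R z) ((toK φ).map_smul a q)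
      | add s t hs ht => rw [smul_add, map_add, hs, ht, map_add, RingHom.id_apply, smul_add] }

theorem tensorToK_tmul (x : M) (q : QBimod φ) :
    tensorToK φ M (Tensor.tmul R x q) = Tensor.tmul R x (toK φ q) := rfl

theorem toK_surjective : Function.Surjective (toK φ) := Submodule.mkQ_surjective _

theorem toK_eq_zero_iff (q : QBimod φ) : toK φ q = 0 ↔ ∃ r : R, toQ φ r = q :=
  Submodule.Quotient.mk_eq_zero _

theorem toK_one : toK φ (oneQ φ) = 0 := (toK_eq_zero_iff φ _).2 ⟨1, φ.map_one⟩

theorem tensorToK_surjective : Function.Surjective (tensorToK φ M) := by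
  intro t
  induction t using Tensor.induction_on with
  | zero => exact ⟨0, map_zero _⟩
  | tmul x k =>
    obtain ⟨q, rfl⟩ := toK_surjective φ k
    exact ⟨Tensor.tmul R x q, rfl⟩
  | add s t hs ht =>
    obtain ⟨s, rfl⟩ := hs
    obtain ⟨t, rfl⟩ := ht
    exact ⟨s + t, map_add _ _ _⟩

/-- If `M` is torsion-free, then `M → M ⊗_R Q` is injective: by flatness its kernel `N` satisfies
`N ⊗_R Q ⊆ M ⊗_R Q`, and the image of `x ⊗ q` there is `(x ⊗ 1) q = 0`, so `N` is torsion. -/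
theorem toTensorQ_injective (hφ : IsLeftFlatBimorphism φ) (htf : IsTorsionFree φ M) :
    Function.Injective (toTensorQ φ M) := by
  rw [← LinearMap.ker_eq_bot]
  refine htf _ (subsingleton_of_forall_eq 0 fun t => ?_)
  refine hφ.flat _ _ _ (LinearMap.ker (toTensorQ φ M)).injective_subtype ?_
  rw [map_zero]
  refine DFunLike.congr_fun (g := (0 : _ →+ _)) (Tensor.hom_ext R fun x q => ?_) t
  have hx : toTensorQ φ M x = 0 := x.2
  calc Tensor.tmul R (x : M) q = tensorMulRight φ M q (toTensorQ φ M x) :=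
        congrArg (fun z : Q => Tensor.tmul R (x : M) (show QBimod φ from z))
          (one_mul (show Q from q)).symm
    _ = 0 := by rw [hx, map_zero]

theorem exact_toTensorQ_tensorToK :
    Function.Exact (toTensorQ φ M) (tensorToK φ M) := by
  intro t
  constructor
  · intro ht
    let I := (LinearMap.range (toTensorQ φ M)).toAddSubgroup
    have hI : ∀ (x : M) (q : QBimod φ), toK φ q = 0 →
        QuotientAddGroup.mk' I (Tensor.tmul R x q) = 0 := by
      intro x q hq
      obtain ⟨r, rfl⟩ := (toK_eq_zero_iff φ q).1 hq
      refine (QuotientAddGroup.eq_zero_iff _).2 ⟨op r • x, ?_⟩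
      rw [toQ_apply, ← Tensor.smul_tmul]
      rfl
    let F : M →+ KBimod φ →+ Tensor R M (QBimod φ) ⧸ I :=
      AddMonoidHom.mk' (fun x => QuotientAddGroup.lift (LinearMap.range (toQ φ)).toAddSubgroup
          ((QuotientAddGroup.mk' I).comp (Tensor.mk R M (QBimod φ) x))
          fun q hq => hI x q ((toK_eq_zero_iff φ q).2 hq))
        fun x y => AddMonoidHom.ext fun k => by
          obtain ⟨q, rfl⟩ := toK_surjective φ k
          exact (congrArg (QuotientAddGroup.mk' I) (Tensor.add_tmul R x y q)).trans (map_add _ _ _)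
    -- the inverse `M ⊗ K → (M ⊗ Q) / im M` of the induced map
    let G : Tensor R M (KBimod φ) →+ Tensor R M (QBimod φ) ⧸ I := Tensor.lift R F fun x r k => by
      obtain ⟨q, rfl⟩ := toK_surjective φ k
      exact congrArg (QuotientAddGroup.mk' I) (Tensor.smul_tmul R r x q)
    have hG : G.comp (tensorToK φ M).toAddMonoidHom = QuotientAddGroup.mk' I :=
      Tensor.hom_ext R fun x q => rfl
    have h0 : QuotientAddGroup.mk' I t = 0 := by
      rw [← hG]
      exact (congrArg G ht).trans (map_zero G)
    exact (QuotientAddGroup.eq_zero_iff _).1 h0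
  · rintro ⟨x, rfl⟩
    exact (congrArg (Tensor.tmul R x) (toK_one φ)).trans (Tensor.tmul_zero R x)

theorem shortExact_tensor (hφ : IsLeftFlatBimorphism φ) (htf : IsTorsionFree φ M) :
    (ModuleCat.shortComplexOfCompEqZero (toTensorQ φ M) (tensorToK φ M)
      (exact_toTensorQ_tensorToK φ M).linearMap_comp_eq_zero).ShortExact :=
  ModuleCat.shortComplex_shortExact _ (exact_toTensorQ_tensorToK φ M)
    (toTensorQ_injective φ M hφ htf) (tensorToK_surjective φ M)

/-! ### The canonical map and its cokernel -/

variable {M} in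
/-- If `M` is `h`-reduced, then `Hom(Q_R, M_R) = 0`, because homomorphic images of `Q_R` are
`h`-divisible. -/
theorem hom_eq_zero_of_isHReduced (hred : IsHReduced φ M) (h : QBimod φ →ₗ[Rᵐᵒᵖ] M) : h = 0 := by
  rw [← LinearMap.range_eq_bot]
  refine hred _ fun f => ?_
  obtain ⟨q, hq⟩ := h.surjective_rangeRestrict (f 1)
  refine ⟨h.rangeRestrict ∘ₗ mulLeftQ φ q, LinearMap.ext fun r => ?_⟩
  have hr : mulLeftQ φ q (toQ φ r) = op r • q := rfl
  rw [LinearMap.comp_apply, LinearMap.comp_apply, hr, map_smul, hq, ← map_smul]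
  exact congrArg f (one_mul r)

/-- If `λ(x) = 0`, then multiplication by `x ⊗ 1` maps `Q` into the image of `M` in `M ⊗_R Q`, so it
comes from a morphism `Q → M`, which is zero. -/
theorem canonicalMap_injective (hφ : IsLeftFlatBimorphism φ) (htf : IsTorsionFree φ M)
    (hred : IsHReduced φ M) : Function.Injective (canonicalMap φ M) := by
  rw [injective_iff_map_eq_zero]
  intro x hx
  let t := mulLeftTensor φ M (toTensorQ φ M x)
  have ht : ∀ q, t q = Tensor.tmul R x q := fun q =>
    congrArg (fun z : Q => Tensor.tmul R x (show QBimod φ from z))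
          (one_mul (show Q from q))
  have hrange : ∀ q, t q ∈ LinearMap.range (toTensorQ φ M) := fun q => by
    refine (exact_toTensorQ_tensorToK φ M _).1 ?_
    rw [ht, tensorToK_tmul, ← canonicalMap_apply, hx]
    rfl
  let e := LinearEquiv.ofInjective _ (toTensorQ_injective φ M hφ htf)
  have h0 := hom_eq_zero_of_isHReduced φ hred (e.symm.toLinearMap ∘ₗ t.codRestrict _ hrange)
  have h1 : e.symm (t.codRestrict _ hrange (oneQ φ)) = 0 := DFunLike.congr_fun h0 (oneQ φ)
  rw [LinearEquiv.map_eq_zero_iff] at h1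
  refine toTensorQ_injective φ M hφ htf ?_
  rw [map_zero]
  exact (ht (oneQ φ)).symm.trans (congrArg Subtype.val h1)

/-- A morphism `K → M ⊗_R K`, viewed as a morphism `Q → M ⊗_R K` in the category of right
`R`-modules. -/
def homOfK (f : RHom R (KBimod φ) (Tensor R M (KBimod φ))) :
    ModuleCat.of Rᵐᵒᵖ (QBimod φ) ⟶ ModuleCat.of Rᵐᵒᵖ (Tensor R M (KBimod φ)) :=
  ModuleCat.ofHom (LinearMap.comp (show KBimod φ →ₗ[Rᵐᵒᵖ] Tensor R M (KBimod φ) from f) (toK φ))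

/-- The connecting morphism `Hom(K, M ⊗_R K) → Hom(Q, M ⊗_R K) → Ext¹(Q, M)`: it sends `f` to the
pullback along `Q → K → M ⊗_R K` of the extension `0 → M → M ⊗_R Q → M ⊗_R K → 0`. -/
noncomputable def connectingMap (hφ : IsLeftFlatBimorphism φ) (htf : IsTorsionFree φ M) :
    RHom R (KBimod φ) (Tensor R M (KBimod φ)) →ₗ[Rᵐᵒᵖ] RExt R (QBimod φ) M where
  toFun f := (Abelian.Ext.mk₀ (homOfK φ M f)).comp (shortExact_tensor φ M hφ htf).extClass
    (zero_add 1)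
  map_add' f g := by
    have h : homOfK φ M (f + g) = homOfK φ M f + homOfK φ M g := rfl
    rw [h, Abelian.Ext.mk₀_add]
    exact Abelian.Ext.add_comp _ _ _ _
  map_smul' a f := by
    have h : homOfK φ M (a • f) = leftMul R (QBimod φ) a.unop ≫ homOfK φ M f := rfl
    rw [h]
    exact (Abelian.Ext.mk₀_comp_mk₀_assoc _ _ _).symm

theorem connectingMap_surjective (hφ : IsLeftFlatBimorphism φ) (htf : IsTorsionFree φ M) :
    Function.Surjective (connectingMap φ M hφ htf) := by
  intro x
  have hS := shortExact_tensor φ M hφ htf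
  obtain ⟨y, hy⟩ := Abelian.Ext.covariant_sequence_exact₁ _ hS x
    ((subsingleton_ext_tensor φ M hφ).elim _ _) (zero_add 1)
  obtain ⟨g, rfl⟩ := (Abelian.Ext.mk₀_bijective _ _).2 y
  -- subtracting a morphism that factors through `M ⊗ Q` makes `g` vanish at `1`
  obtain ⟨t, ht⟩ := tensorToK_surjective φ M (g.hom (oneQ φ))
  let g' : QBimod φ →ₗ[Rᵐᵒᵖ] Tensor R M (KBimod φ) :=
    g.hom - tensorToK φ M ∘ₗ mulLeftTensor φ M t
  have h1 : g' (oneQ φ) = 0 := by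
    change g.hom (oneQ φ) - tensorToK φ M (mulLeftTensor φ M t (oneQ φ)) = 0
    rw [mulLeftTensor_one, ht, sub_self]
  have hker : LinearMap.range (toQ φ) ≤ LinearMap.ker g' := by
    rintro _ ⟨r, rfl⟩
    rw [LinearMap.mem_ker, toQ_apply, ← op_smul_oneQ, map_smul, h1, smul_zero]
  refine ⟨(LinearMap.range (toQ φ)).liftQ g' hker, ?_⟩
  have hg : g = homOfK φ M ((LinearMap.range (toQ φ)).liftQ g' hker) +
      ModuleCat.ofHom (mulLeftTensor φ M t) ≫ ModuleCat.ofHom (tensorToK φ M) :=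
    ModuleCat.hom_ext (LinearMap.ext fun q => (sub_add_cancel (g.hom q) _).symm)
  have hzero : (Abelian.Ext.mk₀ (ModuleCat.ofHom (mulLeftTensor φ M t) ≫
      ModuleCat.ofHom (tensorToK φ M))).comp hS.extClass (zero_add 1) = 0 := by
    rw [← Abelian.Ext.mk₀_comp_mk₀, Abelian.Ext.comp_assoc_of_second_deg_zero]
    exact (congrArg (fun z => Abelian.Ext.comp _ z (zero_add 1)) hS.comp_extClass).trans
      (Abelian.Ext.comp_zero _ _ _ _ _)
  rw [hg, Abelian.Ext.mk₀_add] at hy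
  refine Eq.trans ?_ hy
  refine Eq.trans ?_ (Abelian.Ext.add_comp _ _ _ _).symm
  exact ((congrArg (_ + ·) hzero).trans (add_zero _)).symm

/-- If `f` is killed by the connecting map, then `Q → K → M ⊗_R K` lifts to some `h : Q → M ⊗_R Q`.
Since `f` vanishes at the class of `1`, the element `h(1)` is of the form `x ⊗ 1`, so `h(q) = x ⊗ q`
by `Q`-linearity and `f = λ(x)`. -/
theorem ker_connectingMap (hφ : IsLeftFlatBimorphism φ) (htf : IsTorsionFree φ M) :
    LinearMap.ker (connectingMap φ M hφ htf) = LinearMap.range (canonicalMap φ M) := by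
  have hS := shortExact_tensor φ M hφ htf
  have hlam : ∀ (x : M) (q : QBimod φ),
      tensorToK φ M (mulLeftTensor φ M (toTensorQ φ M x) q) = canonicalMap φ M x (toK φ q) :=
    fun x q => congrArg (fun z : Q => Tensor.tmul R x (toK φ (show QBimod φ from z)))
      (one_mul (show Q from q))
  ext f
  constructor
  · intro hf
    obtain ⟨y, hy⟩ := Abelian.Ext.covariant_sequence_exact₃ _ hS
      (Abelian.Ext.mk₀ (homOfK φ M f)) (zero_add 1) hf
    obtain ⟨h, rfl⟩ := (Abelian.Ext.mk₀_bijective _ _).2 y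
    rw [Abelian.Ext.mk₀_comp_mk₀] at hy
    have hh := (Abelian.Ext.mk₀_bijective _ _).1 hy
    have hq : ∀ q : QBimod φ, tensorToK φ M (h.hom q) = f (toK φ q) := fun q =>
      DFunLike.congr_fun (congrArg ModuleCat.Hom.hom hh) q
    obtain ⟨x, hx⟩ := (exact_toTensorQ_tensorToK φ M (h.hom (oneQ φ))).1 (by
      rw [hq, toK_one]
      exact map_zero (show KBimod φ →ₗ[Rᵐᵒᵖ] Tensor R M (KBimod φ) from f))
    refine ⟨x, LinearMap.ext fun k => ?_⟩
    obtain ⟨q, rfl⟩ := toK_surjective φ k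
    refine (hlam x q).symm.trans (Eq.trans ?_ (hq q))
    rw [hx, ← eq_mulLeftTensor φ M hφ.epi h.hom]
  · rintro ⟨x, rfl⟩
    have h : homOfK φ M (canonicalMap φ M x) = ModuleCat.ofHom
        (mulLeftTensor φ M (toTensorQ φ M x)) ≫ ModuleCat.ofHom (tensorToK φ M) :=
      ModuleCat.hom_ext (LinearMap.ext fun q => (hlam x q).symm)
    change (Abelian.Ext.mk₀ (homOfK φ M (canonicalMap φ M x))).comp hS.extClass (zero_add 1) = 0
    rw [h, ← Abelian.Ext.mk₀_comp_mk₀, Abelian.Ext.comp_assoc_of_second_deg_zero]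
    exact (congrArg (fun z => Abelian.Ext.comp _ z (zero_add 1)) hS.comp_extClass).trans
      (Abelian.Ext.comp_zero _ _ _ _ _)

end

end FlatBimorphism

theorem mainTheorem3 {R Q : Type u} [Ring R] [Ring Q] (φ : R →+* Q)
    (hφ : FlatBimorphism.IsLeftFlatBimorphism φ) (hF : FlatBimorphism.IsOneTopology φ)
    (hQ : ∀ a b : Q, a * b = 1 → b * a = 1)
    (M : Type u) [AddCommGroup M] [Module Rᵐᵒᵖ M]
    (hred : FlatBimorphism.IsHReduced φ M) (htf : FlatBimorphism.IsTorsionFree φ M) :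
    Function.Injective (FlatBimorphism.canonicalMap φ M) ∧
    Nonempty ((FlatBimorphism.RHom R (FlatBimorphism.KBimod φ)
          (FlatBimorphism.Tensor R M (FlatBimorphism.KBimod φ)) ⧸
        LinearMap.range (FlatBimorphism.canonicalMap φ M)) ≃ₗ[Rᵐᵒᵖ]
      FlatBimorphism.RExt R (FlatBimorphism.QBimod φ) M) ∧
    (FlatBimorphism.IsMatlisCotorsion φ M →
      Function.Bijective (FlatBimorphism.canonicalMap φ M)) := by
  have hinj := FlatBimorphism.canonicalMap_injective φ M hφ htf hred
  have hker := FlatBimorphism.ker_connectingMap φ M hφ htf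
  refine ⟨hinj, ⟨(Submodule.quotEquivOfEq _ _ hker.symm).trans
    (LinearMap.quotKerEquivOfSurjective _
      (FlatBimorphism.connectingMap_surjective φ M hφ htf))⟩, fun hC => ⟨hinj, fun f => ?_⟩⟩
  have hf : f ∈ LinearMap.ker (FlatBimorphism.connectingMap φ M hφ htf) := hC.elim _ _
  rwa [hker] at hf
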